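/- Let $N$ and $d$ be natural numbers and let $\rho,\sigma$ be $N$-particle states, i.e. density matrices (positive semidefinite, trace one) on $(\mathbb{C}^d)^{\otimes N}$. Let $$H_{\mathrm{loc}}=\sum_{n=1}^{N} \mathbb 1^{\otimes (n-1)}\otimes h^{(n)}\otimes \mathbb 1^{\otimes (N-n)},$$ where every $h^{(n)}$ is a Hermitian operator on $\mathbb{C}^d$ with operator norm $\|h^{(n)}\|\le 1/2$. For a state $\rho$ with eigenvalues $\lambda_k$ and an orthonormal eigenbasis $|\xi_k\rangle$, the quantum Fisher information for the unitary encoding $e^{-iH\varphi}$ is $$F_Q[\rho;H]=2\sum_{k,l:\ \lambda_k+\lambda_l>0}\frac{(\lambda_k-\lambda_l)^2}{\lambda_k+\lambda_l}\,|\langle\xi_k|H|\xi_l\rangle|^2 .$$ Let $\|X\|_1=\operatorname{Tr}\sqrt{X^\dagger X}$ be the trace norm, $F(\rho,\sigma)=\|\sqrt\rho\sqrt\sigma\|_1$ the Uhlmann fidelity and $D_B(\rho,\sigma)=\sqrt{2(1-F(\rho,\sigma))}$ the Bures distance. Then, with $\xi=8$, $$|F_Q[\rho;H_{\mathrm{loc}}]-F_Q[\sigma;H_{\mathrm{loc}}]|\le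 \xi\,\sqrt{1-F(\rho,\sigma)^2}\;N^2,$$ $$|F_Q[\rho;H_{\mathrm{loc}}]-F_Q[\sigma;H_{\mathrm{loc}}]|\le \xi\,D_B(\rho,\sigma)\,N^2,$$ $$|F_Q[\rho;H_{\mathrm{loc}}]-F_Q[\sigma;H_{\mathrm{loc}}]|\le \xi\,\sqrt{\|\rho-\sigma\|_1}\;N^2 .$$ If at least one of $\rho,\sigma$ is pure (a projector $|\phi\rangle\langle\phi|$ onto a unit vector), all three inequalities hold with $\xi=6$. -/

import Mathlib

open scoped MatrixOrder ComplexOrder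

noncomputable section

/-- Density matrices with rows and columns indexed by `ι`, i.e. mixed states on `ℂ^ι`. -/
structure DensityMatrix (ι : Type*) [Fintype ι] where
  mat : Matrix ι ι ℂ
  posSemidef : mat.PosSemidef
  trace_eq_one : mat.trace = 1

/-- The operator norm `max_{‖ψ‖ = 1} ‖X ψ‖` with respect to the Euclidean norm on `ℂ^ι`. -/
def opNorm {ι : Type*} [Fintype ι] [DecidableEq ι] (X : Matrix ι ι ℂ) : ℝ :=
  ‖Matrix.toEuclideanCLM (𝕜 := ℂ) X‖

/-- The trace norm `‖X‖₁ = Tr √(X† X)`; this trace is a nonnegative real number. -/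
def traceNorm {ι : Type*} [Fintype ι] [DecidableEq ι] (X : Matrix ι ι ℂ) : ℝ :=
  (CFC.sqrt (star X * X)).trace.re

namespace DensityMatrix

variable {ι : Type*} [Fintype ι]

/-- The state is a projector `|ψ⟩⟨ψ|` onto a unit vector `ψ`. -/
def IsPure (ρ : DensityMatrix ι) : Prop :=
  ∃ ψ : EuclideanSpace ℂ ι, ‖ψ‖ = 1 ∧ ∀ i j, ρ.mat i j = ψ i * star (ψ j)

variable [DecidableEq ι]

/-- The Uhlmann fidelity `F(ρ, σ) = ‖√ρ √σ‖₁ = Tr √(√σ ρ √σ)`. -/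
def fidelity (ρ σ : DensityMatrix ι) : ℝ :=
  traceNorm (CFC.sqrt ρ.mat * CFC.sqrt σ.mat)

/-- The Bures distance `√(2 (1 - F(ρ, σ)))`. -/
def buresDist (ρ σ : DensityMatrix ι) : ℝ :=
  Real.sqrt (2 * (1 - fidelity ρ σ))

/-- Eigenvalues of the state, with multiplicity. -/
def eigenvalue (ρ : DensityMatrix ι) (k : ι) : ℝ :=
  ρ.posSemidef.isHermitian.eigenvalues k

/-- An orthonormal basis of eigenvectors of the state. -/
def eigenvector (ρ : DensityMatrix ι) (k : ι) : EuclideanSpace ℂ ι :=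
  ρ.posSemidef.isHermitian.eigenvectorBasis k

/-- The quantum Fisher information of `ρ` under the unitary encoding `exp (-i H φ)`:
`2 ∑_{k,l} (λ_k - λ_l)² / (λ_k + λ_l) |⟨ξ_k| H |ξ_l⟩|²`.
The terms with `λ_k + λ_l = 0` do not contribute (they are `0 / 0 = 0` here). -/
def qfi (ρ : DensityMatrix ι) (H : Matrix ι ι ℂ) : ℝ :=
  2 * ∑ k, ∑ l,
    (ρ.eigenvalue k - ρ.eigenvalue l) ^ 2 / (ρ.eigenvalue k + ρ.eigenvalue l) *
      ‖inner ℂ (ρ.eigenvector k)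
        (Matrix.toEuclideanCLM (𝕜 := ℂ) H (ρ.eigenvector l))‖ ^ 2

end DensityMatrix

/-- The tensor product `A₁ ⊗ ⋯ ⊗ A_N` on `(ℂ^d)^{⊗N}`, whose standard basis is indexed
by `Fin N → Fin d`. -/
def tensorOp {N d : ℕ} (A : Fin N → Matrix (Fin d) (Fin d) ℂ) :
    Matrix (Fin N → Fin d) (Fin N → Fin d) ℂ :=
  Matrix.of fun s t => ∏ m, A m (s m) (t m)

/-- The one-particle operator `h` acting on particle `n` and trivially on all others:
`1 ⊗ ⋯ ⊗ h ⊗ ⋯ ⊗ 1`. -/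
def siteOp {N d : ℕ} (n : Fin N) (h : Matrix (Fin d) (Fin d) ℂ) :
    Matrix (Fin N → Fin d) (Fin N → Fin d) ℂ :=
  tensorOp (Function.update (fun _ => 1) n h)

/-- The Hamiltonian `∑ₙ h⁽ⁿ⁾`, where `h⁽ⁿ⁾` acts on particle `n`. -/
def localHamiltonian {N d : ℕ} (h : Fin N → Matrix (Fin d) (Fin d) ℂ) :
    Matrix (Fin N → Fin d) (Fin N → Fin d) ℂ :=
  ∑ n, siteOp n (h n)

end

/-!
For a state `ρ` and a Hermitian `H`, the Fisher information is a minimum over purifications,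
`F_Q[ρ; H] = 4 min_h ‖H √ρ - √ρ h‖²` in the Hilbert–Schmidt norm, where `h` is a Hermitian operator
on the purifying system. In the eigenbasis of `ρ` this is completing the square in each matrix
element, and the minimizer is `hₖₗ = 2 √(λₖ λₗ) / (λₖ + λₗ) Hₖₗ`
(`qfi_le_frobSq_commutator`, `exists_qfi_eq_frobSq_commutator`). This `h` solves the Lyapunov
equation `h ρ + ρ h = 2 √ρ H √ρ`, which forces `‖h‖ ≤ ‖H‖` in operator norm
(`opNorm_le_of_lyapunov`).

By Uhlmann's theorem some purification `√σ U` of `σ` has overlap `F(ρ, σ)` with `√ρ`, so the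
optimal `h` for `ρ`, used as a trial operator for `σ`, gives
`F_Q[σ] - F_Q[ρ] ≤ 4 (q (√σ U) - q √ρ)` with the quadratic form `q X = ‖H X - X h‖²`. Since
`0 ≤ q ≤ 4 ‖H‖² ‖·‖²`, the values of `q` at two unit vectors with overlap `F` differ by at most
`4 ‖H‖² √(1 - F²)` (`abs_sub_frobSq_commutator_le`). A local Hamiltonian has `‖H‖ ≤ N / 2`, so
the difference of Fisher informations is at most `4 √(1 - F²) N²`. This constant `4` is below both
`6` and `8`, for pure and mixed states alike.

The other two bounds follow from `√(1 - F²) ≤ D_B` and from the Fuchs–van de Graaf inequality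
`D_B² = 2 (1 - F) ≤ ‖ρ - σ‖₁`, a consequence of the Powers–Størmer inequality
`‖√ρ - √σ‖² ≤ ‖ρ - σ‖₁` and of `Tr √ρ √σ ≤ F`.
-/

/-! ### The Hilbert–Schmidt norm -/

section HilbertSchmidt

open Matrix

variable {ι : Type*} [Fintype ι]

/-- The squared Hilbert–Schmidt (Frobenius) norm of a matrix, as a sum over its entries. -/
noncomputable def frobSq (X : Matrix ι ι ℂ) : ℝ :=
  ∑ i, ∑ j, ‖X i j‖ ^ 2

lemma frobSq_nonneg (X : Matrix ι ι ℂ) : 0 ≤ frobSq X :=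
  Finset.sum_nonneg fun _ _ => Finset.sum_nonneg fun _ _ => sq_nonneg _

lemma frobSq_eq_trace (X : Matrix ι ι ℂ) : frobSq X = (Xᴴ * X).trace.re := by
  simp only [frobSq, trace, diag_apply, mul_apply, conjTranspose_apply, Complex.re_sum]
  rw [Finset.sum_comm]
  refine Finset.sum_congr rfl fun i _ => Finset.sum_congr rfl fun j _ => ?_
  rw [Complex.star_def, ← Complex.normSq_eq_conj_mul_self, Complex.ofReal_re,
    Complex.normSq_eq_norm_sq]

lemma frobSq_conjTranspose (X : Matrix ι ι ℂ) : frobSq Xᴴ = frobSq X := by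
  simp only [frobSq, conjTranspose_apply, norm_star]
  exact Finset.sum_comm

lemma trace_conjTranspose_mul_re_comm (X Y : Matrix ι ι ℂ) :
    (Yᴴ * X).trace.re = (Xᴴ * Y).trace.re := by
  have h : Yᴴ * X = (Xᴴ * Y)ᴴ := by simp
  rw [h, trace_conjTranspose, Complex.star_def, Complex.conj_re]

lemma frobSq_linearCombination (a b : ℝ) (X Y : Matrix ι ι ℂ) :
    frobSq ((a : ℂ) • X + (b : ℂ) • Y) =
      a ^ 2 * frobSq X + 2 * (a * b) * (Xᴴ * Y).trace.re + b ^ 2 * frobSq Y := by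
  simp only [frobSq_eq_trace, conjTranspose_add, conjTranspose_smul, add_mul, mul_add,
    smul_mul_assoc, mul_smul_comm, trace_add, trace_smul, Complex.add_re, smul_eq_mul,
    Complex.star_def, Complex.conj_ofReal, Complex.re_ofReal_mul,
    trace_conjTranspose_mul_re_comm X Y]
  ring

lemma frobSq_sub (X Y : Matrix ι ι ℂ) :
    frobSq (X - Y) = frobSq X - 2 * (Xᴴ * Y).trace.re + frobSq Y := by
  have h := frobSq_linearCombination 1 (-1) X Y
  simp only [Complex.ofReal_one, one_smul, Complex.ofReal_neg, neg_smul, ← sub_eq_add_neg] at h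
  rw [h]
  ring

lemma frobSq_sub_le (X Y : Matrix ι ι ℂ) : frobSq (X - Y) ≤ 2 * (frobSq X + frobSq Y) := by
  have h := frobSq_linearCombination 1 1 X Y
  have h0 := frobSq_nonneg (((1 : ℝ) : ℂ) • X + ((1 : ℝ) : ℂ) • Y)
  rw [frobSq_sub]
  linarith

variable [DecidableEq ι]

lemma frobSq_unitary_mul {U : Matrix ι ι ℂ} (hU : Uᴴ * U = 1) (X : Matrix ι ι ℂ) :
    frobSq (U * X) = frobSq X := by
  rw [frobSq_eq_trace, frobSq_eq_trace, conjTranspose_mul, Matrix.mul_assoc,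
    ← Matrix.mul_assoc Uᴴ, hU, Matrix.one_mul]

lemma frobSq_mul_unitary {U : Matrix ι ι ℂ} (hU : U * Uᴴ = 1) (X : Matrix ι ι ℂ) :
    frobSq (X * U) = frobSq X := by
  rw [← frobSq_conjTranspose, conjTranspose_mul, frobSq_unitary_mul (by simpa using hU),
    frobSq_conjTranspose]

/-- The Hilbert–Schmidt norm is submultiplicative against the operator norm; this is the
operator-norm bound on each column. -/
lemma frobSq_mul_le (A X : Matrix ι ι ℂ) : frobSq (A * X) ≤ opNorm A ^ 2 * frobSq X := by
  have col (Z : Matrix ι ι ℂ) : frobSq Z = ∑ j, ‖WithLp.toLp 2 (fun i => Z i j)‖ ^ 2 := by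
    simp only [EuclideanSpace.norm_sq_eq, frobSq]
    exact Finset.sum_comm
  rw [col, col X, Finset.mul_sum]
  refine Finset.sum_le_sum fun j _ => ?_
  rw [← mul_pow]
  have h := (toEuclideanCLM (𝕜 := ℂ) A).le_opNorm (WithLp.toLp 2 (fun i => X i j))
  rw [toEuclideanCLM_toLp] at h
  exact pow_le_pow_left₀ (norm_nonneg _) h 2

lemma opNorm_conjTranspose (A : Matrix ι ι ℂ) : opNorm Aᴴ = opNorm A := by
  rw [opNorm, opNorm, ← star_eq_conjTranspose, map_star, norm_star]

lemma opNorm_nonneg (A : Matrix ι ι ℂ) : 0 ≤ opNorm A := norm_nonneg _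

lemma frobSq_mul_le' (X A : Matrix ι ι ℂ) : frobSq (X * A) ≤ opNorm A ^ 2 * frobSq X := by
  rw [← frobSq_conjTranspose, conjTranspose_mul, ← frobSq_conjTranspose X,
    ← opNorm_conjTranspose A]
  exact frobSq_mul_le _ _

/-- A quadratic form with `0 ≤ q ≤ C ‖·‖²` satisfies `|q X - q Y| ≤ C √(1 - f²)` at unit vectors
`X`, `Y` whose overlap has real part `f`. Here `q Z = ‖H Z - Z K‖²` in the Hilbert–Schmidt norm and
`C = 4 c²`. -/
lemma abs_sub_frobSq_commutator_le {H K : Matrix ι ι ℂ} {c f : ℝ}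
    (hH : opNorm H ≤ c) (hK : opNorm K ≤ c) {X Y : Matrix ι ι ℂ}
    (hX : frobSq X = 1) (hY : frobSq Y = 1) (hf : (Xᴴ * Y).trace.re = f) :
    |frobSq (H * X - X * K) - frobSq (H * Y - Y * K)| ≤ 4 * c ^ 2 * Real.sqrt (1 - f ^ 2) := by
  set q := fun Z => frobSq (H * Z - Z * K) with hq
  have hc : 0 ≤ c := (opNorm_nonneg H).trans hH
  have q_le (Z : Matrix ι ι ℂ) : q Z ≤ 4 * c ^ 2 * frobSq Z := by
    have h1 := frobSq_sub_le (H * Z) (Z * K)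
    have h2 := frobSq_mul_le H Z
    have h3 := frobSq_mul_le' Z K
    have h4 := mul_le_mul_of_nonneg_right (pow_le_pow_left₀ (opNorm_nonneg H) hH 2)
      (frobSq_nonneg Z)
    have h5 := mul_le_mul_of_nonneg_right (pow_le_pow_left₀ (opNorm_nonneg K) hK 2)
      (frobSq_nonneg Z)
    simp only [hq]
    linarith
  obtain ⟨r, hr⟩ : ∃ r : ℝ, ∀ a b : ℝ, q ((a : ℂ) • X + (b : ℂ) • Y) =
      a ^ 2 * q X + 2 * (a * b) * r + b ^ 2 * q Y := by
    refine ⟨((H * X - X * K)ᴴ * (H * Y - Y * K)).trace.re, fun a b => ?_⟩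
    simp only [hq]
    rw [← frobSq_linearCombination]
    congr 1
    simp only [mul_add, add_mul, mul_smul_comm, smul_mul_assoc, smul_sub]
    abel
  -- Polarization along `t (X - Y) ± (X + Y)`; optimizing over `t` is a discriminant inequality.
  have key (t : ℝ) : 0 ≤ (2 * (4 * c ^ 2) * (1 - f)) * (t * t) + (-(4 * (q X - q Y))) * t +
      2 * (4 * c ^ 2) * (1 + f) := by
    have h1 := q_le (((t + 1 : ℝ) : ℂ) • X + ((1 - t : ℝ) : ℂ) • Y)
    have h2 : 0 ≤ q (((t - 1 : ℝ) : ℂ) • X + ((-1 - t : ℝ) : ℂ) • Y) := frobSq_nonneg _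
    rw [hr] at h1 h2
    rw [frobSq_linearCombination, hX, hY, hf] at h1
    nlinarith
  have hd := discrim_le_zero key
  have hsq : (q X - q Y) ^ 2 ≤ (4 * c ^ 2) ^ 2 * (1 - f ^ 2) := by
    rw [discrim] at hd
    nlinarith
  have hC : 0 ≤ 4 * c ^ 2 := by positivity
  calc |q X - q Y| ≤ Real.sqrt ((4 * c ^ 2) ^ 2 * (1 - f ^ 2)) := Real.abs_le_sqrt hsq
    _ = 4 * c ^ 2 * Real.sqrt (1 - f ^ 2) := by
      rw [Real.sqrt_mul (sq_nonneg _), Real.sqrt_sq hC]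

end HilbertSchmidt

/-! ### Polar decomposition and the trace norm -/

section TraceNorm

open Matrix

variable {ι : Type*} [Fintype ι] [DecidableEq ι]

lemma Matrix.IsHermitian.eigenvectorUnitary_conjTranspose_mul {A : Matrix ι ι ℂ}
    (hA : A.IsHermitian) :
    (hA.eigenvectorUnitary : Matrix ι ι ℂ)ᴴ * (hA.eigenvectorUnitary : Matrix ι ι ℂ) = 1 :=
  Unitary.coe_star_mul_self _

lemma Matrix.IsHermitian.eigenvectorUnitary_mul_conjTranspose {A : Matrix ι ι ℂ}
    (hA : A.IsHermitian) :
    (hA.eigenvectorUnitary : Matrix ι ι ℂ) * (hA.eigenvectorUnitary : Matrix ι ι ℂ)ᴴ = 1 :=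
  Unitary.coe_mul_star_self _

lemma Matrix.IsHermitian.eq_mul_diagonal_mul {A : Matrix ι ι ℂ} (hA : A.IsHermitian) :
    A = (hA.eigenvectorUnitary : Matrix ι ι ℂ) *
      diagonal (fun i => (hA.eigenvalues i : ℂ)) * (hA.eigenvectorUnitary : Matrix ι ι ℂ)ᴴ := by
  conv_lhs => rw [hA.spectral_theorem]
  rw [Unitary.conjStarAlgAut_apply]
  rfl

/-- A matrix with orthogonal columns of norms `s i` factors as a unitary times `diagonal s`:
the normalized nonzero columns extend to an orthonormal basis. -/
lemma exists_unitary_mul_diagonal {Y : Matrix ι ι ℂ} {s : ι → ℝ}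
    (hY : Yᴴ * Y = diagonal (fun i => ((s i ^ 2 : ℝ) : ℂ))) :
    ∃ B : Matrix ι ι ℂ, Bᴴ * B = 1 ∧ Y = B * diagonal (fun i => (s i : ℂ)) := by
  have inner_eq (u v : ι → ι → ℂ) (i j : ι) :
      inner ℂ (WithLp.toLp 2 (u i)) (WithLp.toLp 2 (v j)) = ∑ k, star (u i k) * v j k := by
    simp [PiLp.inner_apply, mul_comm]
  have hY' (i j : ι) : ∑ k, star (Y k i) * Y k j = if i = j then ((s i ^ 2 : ℝ) : ℂ) else 0 := by
    have := congrFun (congrFun hY i) j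
    rwa [mul_apply, diagonal_apply] at this
  let w : ι → EuclideanSpace ℂ ι := fun i => WithLp.toLp 2 (fun k => (s i : ℂ)⁻¹ * Y k i)
  have hw : Orthonormal ℂ ({i | s i ≠ 0}.domRestrict w) := by
    rw [orthonormal_iff_ite]
    rintro ⟨i, hi⟩ ⟨j, hj⟩
    have hi' : (s i : ℂ) ≠ 0 := by exact_mod_cast hi
    have : inner ℂ (w i) (w j) = (s i : ℂ)⁻¹ * (s j : ℂ)⁻¹ * ∑ k, star (Y k i) * Y k j := by
      simp only [w]
      rw [inner_eq (fun i k => (s i : ℂ)⁻¹ * Y k i) (fun i k => (s i : ℂ)⁻¹ * Y k i),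
        Finset.mul_sum]
      refine Finset.sum_congr rfl fun k _ => ?_
      simp only [Complex.star_def, map_mul, map_inv₀, Complex.conj_ofReal]
      ring
    simp only [Set.domRestrict_apply, Subtype.mk.injEq]
    rw [this, hY']
    split_ifs with h
    · subst h
      push_cast
      field_simp
    · simp
  obtain ⟨b, hb⟩ := hw.exists_orthonormalBasis_extension_of_card_eq (by simp)
  refine ⟨Matrix.of fun k i => b i k, ?_, ?_⟩
  · ext i j
    have h := orthonormal_iff_ite.mp b.orthonormal i j
    rw [PiLp.inner_apply] at h
    rw [mul_apply, one_apply, ← h]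
    refine Finset.sum_congr rfl fun k _ => ?_
    simp [mul_comm]
  · ext k i
    rw [mul_diagonal, of_apply]
    by_cases hi : s i = 0
    · -- a column of norm zero vanishes
      have h := hY' i i
      rw [if_pos rfl, hi] at h
      have h2 : ∑ k, ‖Y k i‖ ^ 2 = 0 := by
        have : ((∑ k, ‖Y k i‖ ^ 2 : ℝ) : ℂ) = 0 := by
          push_cast
          rw [← (by simpa using h : ∑ k, star (Y k i) * Y k i = 0)]
          exact Finset.sum_congr rfl fun k _ => by
            rw [Complex.star_def, Complex.conj_mul']
        exact_mod_cast this
      have h3 := (Finset.sum_eq_zero_iff_of_nonneg fun _ _ => sq_nonneg _).mp h2 k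
        (Finset.mem_univ k)
      simp [hi, norm_eq_zero.mp (pow_eq_zero_iff two_ne_zero |>.mp h3)]
    · have hi' : (s i : ℂ) ≠ 0 := by exact_mod_cast hi
      rw [hb i hi]
      simp only [w]
      field_simp

/-- Polar decomposition, with a unitary factor also for singular matrices. -/
lemma exists_unitary_mul_sqrt (X : Matrix ι ι ℂ) :
    ∃ W : Matrix ι ι ℂ, Wᴴ * W = 1 ∧ X = W * CFC.sqrt (star X * X) := by
  set P := CFC.sqrt (star X * X) with hP
  have hP0 : P.PosSemidef := nonneg_iff_posSemidef.mp (CFC.sqrt_nonneg _)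
  have hPP : P * P = Xᴴ * X := CFC.sqrt_mul_sqrt_self _ (star_mul_self_nonneg X)
  have hPh := hP0.isHermitian
  set V : Matrix ι ι ℂ := (hPh.eigenvectorUnitary : Matrix ι ι ℂ) with hV
  have hV1 : Vᴴ * V = 1 := hPh.eigenvectorUnitary_conjTranspose_mul
  have hV2 : V * Vᴴ = 1 := hPh.eigenvectorUnitary_mul_conjTranspose
  set D := diagonal (fun i => (hPh.eigenvalues i : ℂ)) with hD
  have hdec : P = V * D * Vᴴ := hPh.eq_mul_diagonal_mul
  have hY : (X * V)ᴴ * (X * V) = diagonal (fun i => ((hPh.eigenvalues i ^ 2 : ℝ) : ℂ)) := by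
    calc (X * V)ᴴ * (X * V) = Vᴴ * (P * P) * V := by
          rw [hPP, conjTranspose_mul]; simp only [Matrix.mul_assoc]
      _ = (Vᴴ * V) * D * (Vᴴ * V) * D * (Vᴴ * V) := by
          rw [hdec]; simp only [Matrix.mul_assoc]
      _ = diagonal (fun i => ((hPh.eigenvalues i ^ 2 : ℝ) : ℂ)) := by
          rw [hV1, Matrix.one_mul, Matrix.mul_one, Matrix.mul_one, hD, diagonal_mul_diagonal]
          simp [pow_two]
  obtain ⟨B, hB, hXB⟩ := exists_unitary_mul_diagonal hY
  refine ⟨B * Vᴴ, ?_, ?_⟩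
  · calc (B * Vᴴ)ᴴ * (B * Vᴴ) = V * (Bᴴ * B) * Vᴴ := by
          rw [conjTranspose_mul, conjTranspose_conjTranspose]; simp only [Matrix.mul_assoc]
      _ = 1 := by rw [hB, Matrix.mul_one, hV2]
  · calc X = X * V * Vᴴ := by rw [Matrix.mul_assoc, hV2, Matrix.mul_one]
      _ = B * (Vᴴ * V) * D * Vᴴ := by rw [hXB, hV1, Matrix.mul_one]
      _ = B * Vᴴ * P := by rw [hdec]; simp only [Matrix.mul_assoc]

/-- The trace norm is attained in its duality with the operator norm, by the adjoint of the
unitary polar factor. -/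
lemma exists_unitary_trace_re_eq_traceNorm (X : Matrix ι ι ℂ) :
    ∃ U : Matrix ι ι ℂ, U * Uᴴ = 1 ∧ (X * U).trace.re = traceNorm X := by
  obtain ⟨W, hW, hX⟩ := exists_unitary_mul_sqrt X
  refine ⟨Wᴴ, by simpa using hW, ?_⟩
  rw [traceNorm]
  conv_lhs => rw [hX]
  rw [trace_mul_comm, ← Matrix.mul_assoc, hW, Matrix.one_mul]

/-- One half of the duality between trace norm and operator norm: with a polar decomposition
`X = W P`, it is Cauchy–Schwarz for `√P Wᴴ` and `√P V`. -/
lemma trace_mul_unitary_re_le_traceNorm (X : Matrix ι ι ℂ) {V : Matrix ι ι ℂ} (hV : V * Vᴴ = 1) :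
    (X * V).trace.re ≤ traceNorm X := by
  obtain ⟨W, hW, hX⟩ := exists_unitary_mul_sqrt X
  have hP0 : 0 ≤ CFC.sqrt (star X * X) := CFC.sqrt_nonneg _
  rw [traceNorm]
  conv_lhs => rw [hX]
  set P := CFC.sqrt (star X * X)
  set Q := CFC.sqrt P with hQ
  have hQQ : Q * Q = P := CFC.sqrt_mul_sqrt_self P hP0
  have hQh : Qᴴ = Q := (nonneg_iff_posSemidef.mp (CFC.sqrt_nonneg P)).isHermitian
  have h := frobSq_nonneg (Q * Wᴴ - Q * V)
  rw [frobSq_sub, frobSq_mul_unitary (by simpa using hW), frobSq_mul_unitary hV, frobSq_eq_trace,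
    conjTranspose_mul, conjTranspose_conjTranspose, hQh, hQQ, Matrix.mul_assoc,
    ← Matrix.mul_assoc Q, hQQ, ← Matrix.mul_assoc] at h
  linarith

/-- The Powers–Størmer inequality. In an eigenbasis `eᵢ` of `A - B`, with eigenvalues `sᵢ`,
`|⟨eᵢ, (A² - B²) eᵢ⟩| = |sᵢ| ⟨eᵢ, (A + B) eᵢ⟩ ≥ sᵢ²`, and the left-hand sides sum to at most the
trace norm of `A² - B²`. -/
lemma Matrix.PosSemidef.frobSq_sub_le_traceNorm {A B : Matrix ι ι ℂ}
    (hA : A.PosSemidef) (hB : B.PosSemidef) : frobSq (A - B) ≤ traceNorm (A * A - B * B) := by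
  have hS : (A - B).IsHermitian := hA.isHermitian.sub hB.isHermitian
  set V : Matrix ι ι ℂ := (hS.eigenvectorUnitary : Matrix ι ι ℂ) with hV
  have hV1 : Vᴴ * V = 1 := hS.eigenvectorUnitary_conjTranspose_mul
  have hV2 : V * Vᴴ = 1 := hS.eigenvectorUnitary_mul_conjTranspose
  set s := hS.eigenvalues with hs
  set D := diagonal (fun i => (s i : ℂ)) with hD
  have hdec : A - B = V * D * Vᴴ := hS.eq_mul_diagonal_mul
  set A' := Vᴴ * A * V with hA'
  set B' := Vᴴ * B * V with hB'
  have hA0 : A'.PosSemidef := hA.conjTranspose_mul_mul_same V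
  have hB0 : B'.PosSemidef := hB.conjTranspose_mul_mul_same V
  have hD' : A' - B' = D := by
    calc A' - B' = Vᴴ * (A - B) * V := by simp only [hA', hB', Matrix.mul_sub, Matrix.sub_mul]
      _ = (Vᴴ * V) * D * (Vᴴ * V) := by rw [hdec]; simp only [Matrix.mul_assoc]
      _ = D := by rw [hV1, Matrix.one_mul, Matrix.mul_one]
  -- the sign of `A - B`, with the value `1` on the kernel
  let ε : ι → ℝ := fun i => if 0 ≤ s i then 1 else -1
  have hε (i : ι) : ε i * ε i = 1 := by
    simp only [ε]; split_ifs <;> norm_num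
  have hεs (i : ι) : ε i * s i = |s i| := by
    simp only [ε]
    split_ifs with h
    · rw [abs_of_nonneg h, one_mul]
    · rw [abs_of_neg (not_le.mp h), neg_one_mul]
  set E := diagonal (fun i => (ε i : ℂ)) with hE
  have hEE : E * Eᴴ = 1 := by
    rw [hE, diagonal_conjTranspose, diagonal_mul_diagonal, ← diagonal_one]
    congr 1
    ext i
    simp only [Pi.star_apply, Complex.star_def, Complex.conj_ofReal, ← Complex.ofReal_mul, hε,
      Complex.ofReal_one]
  have hU : (V * E * Vᴴ) * (V * E * Vᴴ)ᴴ = 1 := by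
    calc _ = V * (E * (Vᴴ * V) * Eᴴ) * Vᴴ := by
          simp only [conjTranspose_mul, conjTranspose_conjTranspose, Matrix.mul_assoc]
      _ = 1 := by rw [hV1, Matrix.mul_one, hEE, Matrix.mul_one, hV2]
  refine le_trans ?_ (trace_mul_unitary_re_le_traceNorm _ hU)
  have hdiag (i : ι) : (A' * A' - B' * B') i i = (s i : ℂ) * (A' i i + B' i i) := by
    have e : (2 : ℂ) • (A' * A' - B' * B') = D * (A' + B') + (A' + B') * D := by
      rw [← hD', two_smul]
      simp only [Matrix.mul_add, Matrix.add_mul, Matrix.mul_sub, Matrix.sub_mul]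
      abel
    have := congrFun (congrFun e i) i
    simp only [Matrix.smul_apply, Matrix.add_apply, hD, diagonal_mul, mul_diagonal,
      smul_eq_mul] at this
    linear_combination this / 2
  have htr : ((A * A - B * B) * (V * E * Vᴴ)).trace.re =
      ∑ i, |s i| * ((A' i i).re + (B' i i).re) := by
    have e : ((A * A - B * B) * (V * E * Vᴴ)).trace = ((A' * A' - B' * B') * E).trace := by
      have e1 : A' * A' - B' * B' = Vᴴ * (A * A - B * B) * V := by
        calc A' * A' - B' * B' = Vᴴ * A * (V * Vᴴ) * A * V - Vᴴ * B * (V * Vᴴ) * B * V := by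
              simp only [hA', hB', Matrix.mul_assoc]
          _ = _ := by
              rw [hV2]
              simp only [Matrix.mul_sub, Matrix.sub_mul, Matrix.mul_one, Matrix.mul_assoc]
      rw [e1, ← Matrix.mul_assoc, trace_mul_comm]
      simp only [Matrix.mul_assoc]
    rw [e, trace, Complex.re_sum]
    refine Finset.sum_congr rfl fun i _ => ?_
    rw [diag_apply, hE, mul_diagonal, hdiag, ← hεs]
    simp only [Complex.mul_re, Complex.mul_im, Complex.ofReal_re, Complex.ofReal_im,
      Complex.add_re]
    ring
  have hfrob : frobSq (A - B) = ∑ i, s i ^ 2 := by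
    rw [hdec, frobSq_mul_unitary (by simpa using hV1), frobSq_unitary_mul hV1, frobSq]
    refine Finset.sum_congr rfl fun i _ => ?_
    rw [Finset.sum_eq_single i]
    · rw [hD, diagonal_apply_eq, Complex.norm_real, Real.norm_eq_abs, sq_abs]
    · intro j _ hj
      simp [hD, diagonal_apply_ne' _ hj]
    · simp
  rw [htr, hfrob]
  refine Finset.sum_le_sum fun i _ => ?_
  have ha : 0 ≤ (A' i i).re := (Complex.nonneg_iff.mp (hA0.diag_nonneg)).1
  have hb : 0 ≤ (B' i i).re := (Complex.nonneg_iff.mp (hB0.diag_nonneg)).1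
  have hsi : s i = (A' i i).re - (B' i i).re := by
    rw [← Complex.sub_re, ← Matrix.sub_apply, hD', hD, diagonal_apply_eq, Complex.ofReal_re]
  rw [← sq_abs, pow_two]
  refine mul_le_mul_of_nonneg_left ?_ (abs_nonneg _)
  rw [hsi, abs_le]
  constructor <;> linarith

end TraceNorm

/-! ### The quantum Fisher information as a minimum over the purifying system -/

section OperatorNorm

open Matrix

variable {ι : Type*} [Fintype ι] [DecidableEq ι]

lemma opNorm_le_of_forall_abs_eigenvalues_le {A : Matrix ι ι ℂ} (hA : A.IsHermitian) {c : ℝ}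
    (hc : 0 ≤ c) (h : ∀ i, |hA.eigenvalues i| ≤ c) : opNorm A ≤ c := by
  open scoped Matrix.Norms.L2Operator in
  rw [opNorm, l2_opNorm_toEuclideanCLM]
  conv_lhs => rw [hA.spectral_theorem]
  rw [Unitary.conjStarAlgAut_apply, ← Unitary.coe_star, CStarRing.norm_mul_coe_unitary,
    CStarRing.norm_coe_unitary_mul, l2_opNorm_diagonal, pi_norm_le_iff_of_nonneg hc]
  intro i
  simpa using h i

lemma inner_toEuclideanCLM_left {A : Matrix ι ι ℂ} (hA : A.IsHermitian)
    (x y : EuclideanSpace ℂ ι) :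
    inner ℂ (toEuclideanCLM (𝕜 := ℂ) A x) y = inner ℂ x (toEuclideanCLM (𝕜 := ℂ) A y) := by
  have h : (toEuclideanCLM (𝕜 := ℂ) A).adjoint = toEuclideanCLM (𝕜 := ℂ) A := by
    rw [← ContinuousLinearMap.star_eq_adjoint, ← map_star, star_eq_conjTranspose, hA]
  conv_lhs => rw [← h]
  rw [ContinuousLinearMap.adjoint_inner_left]

/-- A Hermitian solution of the Lyapunov equation `h R² + R² h = 2 R H R` that vanishes on the
kernel of `R`, as `h = T R` does, has `‖h‖ ≤ ‖H‖`: an eigenvector `v` with eigenvalue `μ` satisfies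
`μ ‖R v‖² = ⟨R v, H R v⟩`. -/
lemma opNorm_le_of_lyapunov {h H R T : Matrix ι ι ℂ} (hh : h.IsHermitian) (hR : R.IsHermitian)
    (hlyap : h * (R * R) + (R * R) * h = (2 : ℂ) • (R * H * R)) (hker : h = T * R) :
    opNorm h ≤ opNorm H := by
  refine opNorm_le_of_forall_abs_eigenvalues_le hh (opNorm_nonneg H) fun i => ?_
  set v := hh.eigenvectorBasis i with hv
  set μ := hh.eigenvalues i with hμ
  set Φ := toEuclideanCLM (𝕜 := ℂ) (n := ι) with hΦ
  have hev : Φ h v = (μ : ℂ) • v := by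
    apply (WithLp.ofLp_injective 2)
    rw [ofLp_toEuclideanCLM, hh.mulVec_eigenvectorBasis]
    rfl
  have hv1 : ‖v‖ = 1 := hh.eigenvectorBasis.orthonormal.1 i
  by_cases hRv : Φ R v = 0
  · have h0 : (μ : ℂ) • v = 0 := by
      rw [← hev, hker, map_mul, mul_apply_eq_comp, hRv, map_zero]
    have hμ0 : μ = 0 := by
      rcases smul_eq_zero.mp h0 with h | h
      · exact_mod_cast h
      · simp [h] at hv1
    rw [hμ0, abs_zero]
    exact opNorm_nonneg H
  · have h1 : inner ℂ v (Φ (h * (R * R) + (R * R) * h) v) = 2 * (μ : ℂ) * (‖Φ R v‖ ^ 2 : ℝ) := by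
      have e1 : inner ℂ v (Φ (h * (R * R)) v) = (μ : ℂ) * inner ℂ (Φ R v) (Φ R v) := by
        rw [map_mul, map_mul, mul_apply_eq_comp, mul_apply_eq_comp,
          ← inner_toEuclideanCLM_left hh, hev, inner_smul_left, Complex.conj_ofReal,
          inner_toEuclideanCLM_left hR]
      have e2 : inner ℂ v (Φ ((R * R) * h) v) = (μ : ℂ) * inner ℂ (Φ R v) (Φ R v) := by
        rw [map_mul, map_mul, mul_apply_eq_comp, mul_apply_eq_comp, hev,
          map_smul, map_smul, inner_smul_right, inner_toEuclideanCLM_left hR]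
      rw [map_add, _root_.add_apply, inner_add_right, e1, e2,
        inner_self_eq_norm_sq_to_K]
      push_cast
      simp only [Complex.coe_algebraMap]
      ring
    have h2 : inner ℂ v (Φ ((2 : ℂ) • (R * H * R)) v) =
        2 * inner ℂ (Φ R v) (Φ H (Φ R v)) := by
      rw [map_smul, _root_.smul_apply, inner_smul_right, map_mul, map_mul,
        mul_apply_eq_comp, mul_apply_eq_comp,
        inner_toEuclideanCLM_left hR]
    rw [hlyap, h2] at h1
    have h3 : ‖inner ℂ (Φ R v) (Φ H (Φ R v))‖ = |μ| * ‖Φ R v‖ ^ 2 := by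
      have : inner ℂ (Φ R v) (Φ H (Φ R v)) = (μ : ℂ) * ((‖Φ R v‖ ^ 2 : ℝ) : ℂ) := by
        linear_combination h1 / 2
      rw [this, norm_mul, Complex.norm_real, Complex.norm_real, Real.norm_eq_abs, Real.norm_eq_abs,
        abs_of_nonneg (sq_nonneg ‖Φ R v‖)]
    have h4 : ‖inner ℂ (Φ R v) (Φ H (Φ R v))‖ ≤ opNorm H * ‖Φ R v‖ ^ 2 := by
      refine (norm_inner_le_norm _ _).trans ?_
      have := mul_le_mul_of_nonneg_left ((Φ H).le_opNorm (Φ R v)) (norm_nonneg (Φ R v))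
      calc _ ≤ _ := this
        _ = opNorm H * ‖Φ R v‖ ^ 2 := by rw [opNorm]; ring
    rw [h3] at h4
    exact le_of_mul_le_mul_right h4 (by positivity)

end OperatorNorm

/-- Completing the square in the pair of matrix elements `(k, l)`, `(l, k)`: for `x = √λₖ` and
`y = √λₗ`, the Fisher information term of `a` is the minimum over `b`, attained where
`(x² + y²) b = 2 x y a`. -/
lemma sq_norm_add_sq_norm_eq (x y : ℝ) (a b : ℂ) :
    (x ^ 2 + y ^ 2) * (‖a * y - x * b‖ ^ 2 + ‖a * x - y * b‖ ^ 2) =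
      (x ^ 2 - y ^ 2) ^ 2 * ‖a‖ ^ 2 +
        ‖((x ^ 2 + y ^ 2 : ℝ) : ℂ) * b - ((2 * x * y : ℝ) : ℂ) * a‖ ^ 2 := by
  simp only [← Complex.normSq_eq_norm_sq, Complex.normSq_apply, Complex.sub_re, Complex.sub_im,
    Complex.mul_re, Complex.mul_im, Complex.ofReal_re, Complex.ofReal_im]
  ring

/-- For `x = y = 0` the left-hand side is `0 / 0 * ‖a‖ ^ 2 = 0`. -/
lemma div_mul_sq_norm_le (x y : ℝ) (a b : ℂ) :
    (x ^ 2 - y ^ 2) ^ 2 / (x ^ 2 + y ^ 2) * ‖a‖ ^ 2 ≤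
      ‖a * y - x * b‖ ^ 2 + ‖a * x - y * b‖ ^ 2 := by
  rcases (by positivity : 0 ≤ x ^ 2 + y ^ 2).eq_or_lt with h | h
  · rw [← h, div_zero, zero_mul]
    positivity
  · rw [div_mul_eq_mul_div, div_le_iff₀ h, mul_comm (_ + _), sq_norm_add_sq_norm_eq]
    linarith [sq_nonneg ‖((x ^ 2 + y ^ 2 : ℝ) : ℂ) * b - ((2 * x * y : ℝ) : ℂ) * a‖]

lemma div_mul_sq_norm_eq (x y : ℝ) (a : ℂ) :
    (x ^ 2 - y ^ 2) ^ 2 / (x ^ 2 + y ^ 2) * ‖a‖ ^ 2 =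
      ‖a * y - x * (((2 * x * y / (x ^ 2 + y ^ 2) : ℝ) : ℂ) * a)‖ ^ 2 +
        ‖a * x - y * (((2 * x * y / (x ^ 2 + y ^ 2) : ℝ) : ℂ) * a)‖ ^ 2 := by
  rcases (by positivity : 0 ≤ x ^ 2 + y ^ 2).eq_or_lt with h | h
  · have hx : x = 0 := by nlinarith [sq_nonneg x, sq_nonneg y]
    have hy : y = 0 := by nlinarith [sq_nonneg x, sq_nonneg y]
    simp [hx, hy]
  · have key := sq_norm_add_sq_norm_eq x y a (((2 * x * y / (x ^ 2 + y ^ 2) : ℝ) : ℂ) * a)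
    rw [← mul_assoc (((x ^ 2 + y ^ 2 : ℝ) : ℂ)), ← Complex.ofReal_mul, mul_div_cancel₀ _ h.ne',
      sub_self, norm_zero] at key
    rw [div_mul_eq_mul_div, div_eq_iff h.ne', mul_comm (_ + _), key]
    ring

namespace DensityMatrix

open Matrix

variable {ι : Type*} [Fintype ι] [DecidableEq ι] (ρ : DensityMatrix ι)

/-- The unitary matrix whose columns are the eigenvectors of the state. -/
noncomputable def eigenMatrix : Matrix ι ι ℂ :=
  (ρ.posSemidef.isHermitian.eigenvectorUnitary : Matrix ι ι ℂ)

lemma eigenMatrix_conjTranspose_mul : ρ.eigenMatrixᴴ * ρ.eigenMatrix = 1 :=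
  ρ.posSemidef.isHermitian.eigenvectorUnitary_conjTranspose_mul

lemma eigenMatrix_mul_conjTranspose : ρ.eigenMatrix * ρ.eigenMatrixᴴ = 1 :=
  ρ.posSemidef.isHermitian.eigenvectorUnitary_mul_conjTranspose

lemma eigenvalue_nonneg (k : ι) : 0 ≤ ρ.eigenvalue k := ρ.posSemidef.eigenvalues_nonneg k

lemma sqrt_posSemidef : (CFC.sqrt ρ.mat).PosSemidef :=
  nonneg_iff_posSemidef.mp (CFC.sqrt_nonneg _)

lemma sqrt_isHermitian : (CFC.sqrt ρ.mat).IsHermitian := ρ.sqrt_posSemidef.isHermitian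

lemma sqrt_mul_sqrt : CFC.sqrt ρ.mat * CFC.sqrt ρ.mat = ρ.mat :=
  CFC.sqrt_mul_sqrt_self _ (nonneg_iff_posSemidef.mpr ρ.posSemidef)

lemma frobSq_sqrt : frobSq (CFC.sqrt ρ.mat) = 1 := by
  rw [frobSq_eq_trace, ρ.sqrt_isHermitian, ρ.sqrt_mul_sqrt, ρ.trace_eq_one, Complex.one_re]

lemma sqrt_eq : CFC.sqrt ρ.mat = ρ.eigenMatrix *
    diagonal (fun k => (Real.sqrt (ρ.eigenvalue k) : ℂ)) * ρ.eigenMatrixᴴ := by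
  refine CFC.sqrt_unique ?_ ?_
  · calc _ = ρ.eigenMatrix * diagonal (fun k => (Real.sqrt (ρ.eigenvalue k) : ℂ)) *
          (ρ.eigenMatrixᴴ * ρ.eigenMatrix) *
          diagonal (fun k => (Real.sqrt (ρ.eigenvalue k) : ℂ)) * ρ.eigenMatrixᴴ := by
          simp only [Matrix.mul_assoc]
      _ = ρ.eigenMatrix * diagonal (fun k => (ρ.eigenvalue k : ℂ)) * ρ.eigenMatrixᴴ := by
          rw [ρ.eigenMatrix_conjTranspose_mul, Matrix.mul_one, Matrix.mul_assoc ρ.eigenMatrix,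
            diagonal_mul_diagonal]
          simp only [← Complex.ofReal_mul, Real.mul_self_sqrt (ρ.eigenvalue_nonneg _)]
      _ = ρ.mat := ρ.posSemidef.isHermitian.eq_mul_diagonal_mul.symm
  · refine nonneg_iff_posSemidef.mpr (PosSemidef.mul_mul_conjTranspose_same ?_ _)
    exact PosSemidef.diagonal fun k => by
      simp [Real.sqrt_nonneg]

lemma inner_eigenvector_apply (H : Matrix ι ι ℂ) (k l : ι) :
    inner ℂ (ρ.eigenvector k) (toEuclideanCLM (𝕜 := ℂ) H (ρ.eigenvector l)) =
      (ρ.eigenMatrixᴴ * H * ρ.eigenMatrix) k l := by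
  rw [Matrix.mul_assoc, mul_apply, PiLp.inner_apply]
  refine Finset.sum_congr rfl fun i _ => ?_
  rw [ofLp_toEuclideanCLM, RCLike.inner_apply, conjTranspose_apply, mul_comm]
  rfl

/-- The cost `‖H √ρ - √ρ h‖²` in the eigenbasis of `ρ`. -/
lemma frobSq_commutator_eq (H h : Matrix ι ι ℂ) :
    frobSq (H * CFC.sqrt ρ.mat - CFC.sqrt ρ.mat * h) =
      ∑ k, ∑ l, ‖(ρ.eigenMatrixᴴ * H * ρ.eigenMatrix) k l * (Real.sqrt (ρ.eigenvalue l) : ℂ) -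
        (Real.sqrt (ρ.eigenvalue k) : ℂ) * (ρ.eigenMatrixᴴ * h * ρ.eigenMatrix) k l‖ ^ 2 := by
  set V := ρ.eigenMatrix with hV
  have hV1 : Vᴴ * V = 1 := ρ.eigenMatrix_conjTranspose_mul
  have hV2 : V * Vᴴ = 1 := ρ.eigenMatrix_mul_conjTranspose
  set S := diagonal (fun k => (Real.sqrt (ρ.eigenvalue k) : ℂ)) with hS
  rw [← frobSq_mul_unitary hV2, ← frobSq_unitary_mul (U := Vᴴ) (by simpa using hV2)]
  have : Vᴴ * ((H * CFC.sqrt ρ.mat - CFC.sqrt ρ.mat * h) * V) =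
      (Vᴴ * H * V) * S - S * (Vᴴ * h * V) := by
    rw [ρ.sqrt_eq, ← hV, ← hS]
    calc _ = Vᴴ * H * V * S * (Vᴴ * V) - (Vᴴ * V) * S * Vᴴ * h * V := by
          simp only [Matrix.mul_assoc, Matrix.sub_mul, Matrix.mul_sub]
      _ = _ := by rw [hV1]; simp only [Matrix.mul_assoc, Matrix.one_mul, Matrix.mul_one]
  rw [this]
  simp only [frobSq, Matrix.sub_apply, hS, mul_diagonal, diagonal_mul]

lemma isHermitian_conj_eigenMatrix {h : Matrix ι ι ℂ} (hh : h.IsHermitian) :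
    (ρ.eigenMatrixᴴ * h * ρ.eigenMatrix).IsHermitian :=
  isHermitian_conjTranspose_mul_mul _ hh

/-- Pairing the index `(k, l)` with `(l, k)`. -/
lemma four_mul_frobSq_commutator_eq {H h : Matrix ι ι ℂ} (hH : H.IsHermitian)
    (hh : h.IsHermitian) :
    4 * frobSq (H * CFC.sqrt ρ.mat - CFC.sqrt ρ.mat * h) =
      2 * ∑ k, ∑ l,
        (‖(ρ.eigenMatrixᴴ * H * ρ.eigenMatrix) k l * (Real.sqrt (ρ.eigenvalue l) : ℂ) -
          (Real.sqrt (ρ.eigenvalue k) : ℂ) * (ρ.eigenMatrixᴴ * h * ρ.eigenMatrix) k l‖ ^ 2 +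
        ‖(ρ.eigenMatrixᴴ * H * ρ.eigenMatrix) k l * (Real.sqrt (ρ.eigenvalue k) : ℂ) -
          (Real.sqrt (ρ.eigenvalue l) : ℂ) * (ρ.eigenMatrixᴴ * h * ρ.eigenMatrix) k l‖ ^ 2) := by
  rw [frobSq_commutator_eq]
  have hH' := ρ.isHermitian_conj_eigenMatrix hH
  have hh' := ρ.isHermitian_conj_eigenMatrix hh
  set A := ρ.eigenMatrixᴴ * H * ρ.eigenMatrix
  set B := ρ.eigenMatrixᴴ * h * ρ.eigenMatrix
  have swap : ∑ k, ∑ l, ‖A k l * (Real.sqrt (ρ.eigenvalue k) : ℂ) -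
      (Real.sqrt (ρ.eigenvalue l) : ℂ) * B k l‖ ^ 2 =
      ∑ k, ∑ l, ‖A k l * (Real.sqrt (ρ.eigenvalue l) : ℂ) -
        (Real.sqrt (ρ.eigenvalue k) : ℂ) * B k l‖ ^ 2 := by
    rw [Finset.sum_comm]
    refine Finset.sum_congr rfl fun k _ => Finset.sum_congr rfl fun l _ => ?_
    rw [← norm_star, ← hH'.apply l k, ← hh'.apply l k]
    simp
  simp only [Finset.sum_add_distrib]
  rw [swap]
  ring

lemma qfi_eq_sum_sqrt (H : Matrix ι ι ℂ) :
    ρ.qfi H = 2 * ∑ k, ∑ l,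
      (Real.sqrt (ρ.eigenvalue k) ^ 2 - Real.sqrt (ρ.eigenvalue l) ^ 2) ^ 2 /
        (Real.sqrt (ρ.eigenvalue k) ^ 2 + Real.sqrt (ρ.eigenvalue l) ^ 2) *
          ‖(ρ.eigenMatrixᴴ * H * ρ.eigenMatrix) k l‖ ^ 2 := by
  simp only [qfi, inner_eigenvector_apply, Real.sq_sqrt (ρ.eigenvalue_nonneg _)]

lemma qfi_le_frobSq_commutator_sqrt {H h : Matrix ι ι ℂ} (hH : H.IsHermitian)
    (hh : h.IsHermitian) :
    ρ.qfi H ≤ 4 * frobSq (H * CFC.sqrt ρ.mat - CFC.sqrt ρ.mat * h) := by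
  rw [ρ.four_mul_frobSq_commutator_eq hH hh, qfi_eq_sum_sqrt]
  gcongr
  exact div_mul_sq_norm_le _ _ _ _

/-- Every purification of the state, written as a matrix `√ρ U`, bounds the Fisher information by
the cost of any Hermitian `h` on the purifying system. -/
lemma qfi_le_frobSq_commutator {H h U : Matrix ι ι ℂ} (hH : H.IsHermitian)
    (hh : h.IsHermitian) (hU : U * Uᴴ = 1) :
    ρ.qfi H ≤ 4 * frobSq (H * (CFC.sqrt ρ.mat * U) - (CFC.sqrt ρ.mat * U) * h) := by
  have hU' : Uᴴ * U = 1 := mul_eq_one_comm.mp hU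
  have hUh : (U * h * Uᴴ).IsHermitian := isHermitian_mul_mul_conjTranspose _ hh
  refine (ρ.qfi_le_frobSq_commutator_sqrt hH hUh).trans_eq ?_
  rw [← frobSq_mul_unitary hU]
  congr 2
  calc _ = H * (CFC.sqrt ρ.mat * U) - CFC.sqrt ρ.mat * U * h * (Uᴴ * U) := by
        simp only [Matrix.mul_assoc, Matrix.sub_mul]
    _ = _ := by rw [hU', Matrix.mul_one]

/-- The minimum over the purifying system is attained at a Hermitian `h` no larger than `H`. In
the eigenbasis of `ρ`, `hₖₗ = 2 √(λₖ λₗ) / (λₖ + λₗ) Hₖₗ`. -/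
lemma exists_qfi_eq_frobSq_commutator {H : Matrix ι ι ℂ} (hH : H.IsHermitian) :
    ∃ h : Matrix ι ι ℂ, h.IsHermitian ∧ opNorm h ≤ opNorm H ∧
      ρ.qfi H = 4 * frobSq (H * CFC.sqrt ρ.mat - CFC.sqrt ρ.mat * h) := by
  have hH' := ρ.isHermitian_conj_eigenMatrix hH
  set V := ρ.eigenMatrix with hV
  have hV1 : Vᴴ * V = 1 := ρ.eigenMatrix_conjTranspose_mul
  have hV2 : V * Vᴴ = 1 := ρ.eigenMatrix_mul_conjTranspose
  set A := Vᴴ * H * V with hA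
  set s : ι → ℝ := fun k => Real.sqrt (ρ.eigenvalue k) with hs
  set S := diagonal (fun k => (s k : ℂ)) with hS
  have hR : CFC.sqrt ρ.mat = V * S * Vᴴ := ρ.sqrt_eq
  let B : Matrix ι ι ℂ := of fun k l => ((2 * s k * s l / (s k ^ 2 + s l ^ 2) : ℝ) : ℂ) * A k l
  let T : Matrix ι ι ℂ := of fun k l => ((2 * s k / (s k ^ 2 + s l ^ 2) : ℝ) : ℂ) * A k l
  have hB : B.IsHermitian := by
    ext k l
    simp only [conjTranspose_apply, B, of_apply, star_mul', hH'.apply, Complex.star_def,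
      Complex.conj_ofReal]
    congr 2
    ring
  have hh : (V * B * Vᴴ).IsHermitian := isHermitian_mul_mul_conjTranspose _ hB
  have hBT : B = T * S := by
    ext k l
    simp only [B, T, hS, mul_diagonal, of_apply]
    push_cast
    ring
  have hlyap : B * (S * S) + (S * S) * B = (2 : ℂ) • (S * A * S) := by
    ext k l
    simp only [hS, diagonal_mul_diagonal, Matrix.add_apply, mul_diagonal, diagonal_mul,
      Matrix.smul_apply, smul_eq_mul, B, of_apply]
    by_cases h0 : s k ^ 2 + s l ^ 2 = 0
    · have hk : s k = 0 := by nlinarith [sq_nonneg (s k), sq_nonneg (s l)]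
      have hl : s l = 0 := by nlinarith [sq_nonneg (s k), sq_nonneg (s l)]
      simp [hk, hl]
    · have h0' : (s k : ℂ) ^ 2 + (s l : ℂ) ^ 2 ≠ 0 := by exact_mod_cast h0
      push_cast
      field_simp
      ring
  have conj (X Y : Matrix ι ι ℂ) : (V * X * Vᴴ) * (V * Y * Vᴴ) = V * (X * Y) * Vᴴ := by
    calc _ = V * X * (Vᴴ * V) * Y * Vᴴ := by simp only [Matrix.mul_assoc]
      _ = _ := by rw [hV1]; simp only [Matrix.mul_assoc, Matrix.one_mul]
  have hHA : H = V * A * Vᴴ := by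
    calc H = (V * Vᴴ) * H * (V * Vᴴ) := by rw [hV2, Matrix.one_mul, Matrix.mul_one]
      _ = _ := by rw [hA]; simp only [Matrix.mul_assoc]
  refine ⟨V * B * Vᴴ, hh, ?_, ?_⟩
  · refine opNorm_le_of_lyapunov (T := V * T * Vᴴ) hh ρ.sqrt_isHermitian ?_ ?_
    · conv_rhs => rw [hHA]
      rw [hR]
      simp only [conj]
      rw [← Matrix.add_mul, ← Matrix.mul_add, hlyap, Matrix.mul_smul, Matrix.smul_mul]
    · rw [hR, conj, hBT]
  · rw [ρ.four_mul_frobSq_commutator_eq hH hh, qfi_eq_sum_sqrt]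
    have hVB : Vᴴ * (V * B * Vᴴ) * V = B := by
      calc _ = (Vᴴ * V) * B * (Vᴴ * V) := by simp only [Matrix.mul_assoc]
        _ = B := by rw [hV1, Matrix.one_mul, Matrix.mul_one]
    rw [← hV, hVB, ← hA]
    congr 1
    refine Finset.sum_congr rfl fun k _ => Finset.sum_congr rfl fun l _ => ?_
    exact div_mul_sq_norm_eq (s k) (s l) (A k l)

end DensityMatrix

/-! ### Fidelity and trace distance -/

namespace DensityMatrix

open Matrix

variable {ι : Type*} [Fintype ι] [DecidableEq ι] (ρ σ : DensityMatrix ι)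

/-- Uhlmann's theorem, in the direction giving purifications `√ρ` and `√σ U` with overlap
`F(ρ, σ)`. -/
lemma exists_purification_overlap_eq_fidelity :
    ∃ U : Matrix ι ι ℂ, U * Uᴴ = 1 ∧ frobSq (CFC.sqrt σ.mat * U) = 1 ∧
      ((CFC.sqrt ρ.mat)ᴴ * (CFC.sqrt σ.mat * U)).trace.re = ρ.fidelity σ := by
  obtain ⟨U, hU, h⟩ := exists_unitary_trace_re_eq_traceNorm (CFC.sqrt ρ.mat * CFC.sqrt σ.mat)
  refine ⟨U, hU, ?_, ?_⟩
  · rw [frobSq_mul_unitary hU, frobSq_sqrt]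
  · rw [ρ.sqrt_isHermitian, ← Matrix.mul_assoc, h, fidelity]

lemma fidelity_comm : σ.fidelity ρ = ρ.fidelity σ := by
  have le (ρ σ : DensityMatrix ι) : ρ.fidelity σ ≤ σ.fidelity ρ := by
    obtain ⟨U, hU, h⟩ := exists_unitary_trace_re_eq_traceNorm (CFC.sqrt ρ.mat * CFC.sqrt σ.mat)
    have h2 := trace_mul_unitary_re_le_traceNorm (CFC.sqrt σ.mat * CFC.sqrt ρ.mat)
      (V := Uᴴ) (by simpa using mul_eq_one_comm.mp hU)
    refine (h.symm.trans ?_).trans_le h2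
    have e : (CFC.sqrt σ.mat * CFC.sqrt ρ.mat * Uᴴ).trace =
        star (CFC.sqrt ρ.mat * CFC.sqrt σ.mat * U).trace := by
      rw [← trace_conjTranspose, conjTranspose_mul, conjTranspose_mul, ρ.sqrt_isHermitian,
        σ.sqrt_isHermitian, trace_mul_comm]
    rw [e, Complex.star_def, Complex.conj_re]
  exact le_antisymm (le _ _) (le _ _)

/-- A Fuchs–van de Graaf inequality: Powers–Størmer bounds `‖√ρ - √σ‖² = 2 - 2 Tr √ρ √σ`, and
`Tr √ρ √σ ≤ F(ρ, σ)`. -/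
lemma two_mul_one_sub_fidelity_le_traceNorm :
    2 * (1 - ρ.fidelity σ) ≤ traceNorm (ρ.mat - σ.mat) := by
  have h1 := ρ.sqrt_posSemidef.frobSq_sub_le_traceNorm σ.sqrt_posSemidef
  have h2 := trace_mul_unitary_re_le_traceNorm (CFC.sqrt ρ.mat * CFC.sqrt σ.mat) (V := 1) (by simp)
  rw [sqrt_mul_sqrt, sqrt_mul_sqrt, frobSq_sub, frobSq_sqrt, frobSq_sqrt,
    ρ.sqrt_isHermitian] at h1
  rw [Matrix.mul_one] at h2
  rw [fidelity]
  linarith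

lemma buresDist_le_sqrt_traceNorm :
    ρ.buresDist σ ≤ Real.sqrt (traceNorm (ρ.mat - σ.mat)) :=
  Real.sqrt_le_sqrt (ρ.two_mul_one_sub_fidelity_le_traceNorm σ)

lemma sqrt_one_sub_fidelity_sq_le_buresDist :
    Real.sqrt (1 - ρ.fidelity σ ^ 2) ≤ ρ.buresDist σ :=
  Real.sqrt_le_sqrt (by nlinarith [sq_nonneg (1 - ρ.fidelity σ)])

/-- Continuity of the Fisher information: the optimal `h` for `ρ` is a trial operator for `σ`. -/
lemma qfi_sub_le {H : Matrix ι ι ℂ} (hH : H.IsHermitian) :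
    σ.qfi H - ρ.qfi H ≤ 16 * opNorm H ^ 2 * Real.sqrt (1 - ρ.fidelity σ ^ 2) := by
  obtain ⟨h, hh, hn, hq⟩ := ρ.exists_qfi_eq_frobSq_commutator hH
  obtain ⟨U, hU, h1, h2⟩ := ρ.exists_purification_overlap_eq_fidelity σ
  have h3 := σ.qfi_le_frobSq_commutator hH hh hU
  have h4 := (abs_le.mp (abs_sub_frobSq_commutator_le le_rfl hn ρ.frobSq_sqrt h1 h2)).1
  linarith

lemma abs_qfi_sub_le {H : Matrix ι ι ℂ} (hH : H.IsHermitian) :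
    |ρ.qfi H - σ.qfi H| ≤ 16 * opNorm H ^ 2 * Real.sqrt (1 - ρ.fidelity σ ^ 2) := by
  have h1 := ρ.qfi_sub_le σ hH
  have h2 := σ.qfi_sub_le ρ hH
  rw [fidelity_comm] at h2
  exact abs_le.mpr ⟨by linarith, h2⟩

end DensityMatrix

/-! ### Local Hamiltonians -/

section LocalHamiltonian

open Matrix

variable {N d : ℕ}

lemma siteOp_apply (n : Fin N) (h : Matrix (Fin d) (Fin d) ℂ) (s t : Fin N → Fin d) :
    siteOp n h s t = h (s n) (t n) * ∏ m ∈ Finset.univ.erase n, if s m = t m then 1 else 0 := by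
  rw [siteOp, tensorOp, of_apply, ← Finset.mul_prod_erase _ _ (Finset.mem_univ n),
    Function.update_self]
  congr 1
  refine Finset.prod_congr rfl fun m hm => ?_
  rw [Function.update_of_ne (Finset.ne_of_mem_erase hm), one_apply]

lemma siteOp_isHermitian (n : Fin N) {h : Matrix (Fin d) (Fin d) ℂ} (hh : h.IsHermitian) :
    (siteOp n h).IsHermitian := by
  ext s t
  rw [conjTranspose_apply, siteOp_apply, siteOp_apply, star_mul', hh.apply, star_prod]
  congr 1
  refine Finset.prod_congr rfl fun m _ => ?_
  simp only [eq_comm (a := t m)]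
  split_ifs <;> simp

/-- Only the configurations that agree with `s` off site `n` are reached from `s`. -/
lemma siteOp_mulVec (n : Fin N) (h : Matrix (Fin d) (Fin d) ℂ) (x : (Fin N → Fin d) → ℂ)
    (s : Fin N → Fin d) :
    (siteOp n h *ᵥ x) s = ∑ a, h (s n) a * x (Function.update s n a) := by
  rw [mulVec, dotProduct]
  have hinj : Function.Injective (fun a => Function.update s n a) := Function.update_injective s n
  rw [← Finset.sum_subset (Finset.subset_univ (Finset.univ.map ⟨_, hinj⟩)), Finset.sum_map]
  · refine Finset.sum_congr rfl fun a _ => ?_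
    rw [siteOp_apply, Function.Embedding.coeFn_mk, Function.update_self, Finset.prod_eq_one,
      mul_one]
    intro m hm
    rw [if_pos (Function.update_of_ne (Finset.ne_of_mem_erase hm) _ _).symm]
  · intro t _ ht
    have : ∃ m, m ≠ n ∧ s m ≠ t m := by
      by_contra! hcon
      refine ht (Finset.mem_map.mpr ⟨t n, Finset.mem_univ _, ?_⟩)
      ext1 m
      rw [Function.Embedding.coeFn_mk]
      rcases eq_or_ne m n with rfl | hm
      · rw [Function.update_self]
      · rw [Function.update_of_ne hm, hcon m hm]
    obtain ⟨m, hm, hst⟩ := this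
    rw [siteOp_apply, Finset.prod_eq_zero (Finset.mem_erase.mpr ⟨hm, Finset.mem_univ m⟩)
      (if_neg hst), mul_zero, zero_mul]

/-- Fixing the configuration of the other particles, `siteOp n h` acts as `h`. -/
lemma opNorm_siteOp_le (n : Fin N) (h : Matrix (Fin d) (Fin d) ℂ) :
    opNorm (siteOp n h) ≤ opNorm h := by
  refine ContinuousLinearMap.opNorm_le_bound _ (opNorm_nonneg h) fun x => ?_
  refine le_of_sq_le_sq ?_ (mul_nonneg (opNorm_nonneg h) (norm_nonneg x))
  rw [mul_pow, EuclideanSpace.norm_sq_eq, EuclideanSpace.norm_sq_eq]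
  let e := Equiv.funSplitAt n (Fin d)
  have hupd (b a : Fin d) (r : {m // m ≠ n} → Fin d) :
      Function.update (e.symm (b, r)) n a = e.symm (a, r) := by
    ext1 m
    rcases eq_or_ne m n with rfl | hm
    · simp [e, Equiv.funSplitAt, Equiv.piSplitAt]
    · simp [e, Equiv.funSplitAt, Equiv.piSplitAt, hm]
  have hn (b : Fin d) (r : {m // m ≠ n} → Fin d) : e.symm (b, r) n = b := by
    simp [e, Equiv.funSplitAt, Equiv.piSplitAt]
  rw [← Equiv.sum_comp e.symm, ← Equiv.sum_comp e.symm (fun s => ‖x s‖ ^ 2),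
    Fintype.sum_prod_type_right, Fintype.sum_prod_type_right, Finset.mul_sum]
  refine Finset.sum_le_sum fun r _ => ?_
  have hle := (toEuclideanCLM (𝕜 := ℂ) h).le_opNorm (WithLp.toLp 2 fun a => x (e.symm (a, r)))
  have hsq := pow_le_pow_left₀ (norm_nonneg _) hle 2
  rw [mul_pow, EuclideanSpace.norm_sq_eq, EuclideanSpace.norm_sq_eq, toEuclideanCLM_toLp] at hsq
  refine le_of_eq_of_le (Finset.sum_congr rfl fun b _ => ?_) hsq
  rw [ofLp_toEuclideanCLM, siteOp_mulVec]
  simp only [hupd, hn]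
  rfl

lemma localHamiltonian_isHermitian {h : Fin N → Matrix (Fin d) (Fin d) ℂ}
    (hh : ∀ n, (h n).IsHermitian) : (localHamiltonian h).IsHermitian := by
  rw [localHamiltonian, IsHermitian, conjTranspose_sum]
  exact Finset.sum_congr rfl fun n _ => siteOp_isHermitian n (hh n)

lemma opNorm_localHamiltonian_le {h : Fin N → Matrix (Fin d) (Fin d) ℂ}
    (hh : ∀ n, opNorm (h n) ≤ 1 / 2) : opNorm (localHamiltonian h) ≤ N / 2 := by
  rw [opNorm, localHamiltonian, map_sum]
  refine (norm_sum_le _ _).trans ?_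
  refine (Finset.sum_le_card_nsmul _ _ (1 / 2) fun n _ =>
    (opNorm_siteOp_le n (h n)).trans (hh n)).trans_eq ?_
  rw [Finset.card_univ, Fintype.card_fin, nsmul_eq_mul]
  ring

end LocalHamiltonian

theorem mainTheorem2 (N d : ℕ) (h : Fin N → Matrix (Fin d) (Fin d) ℂ)
    (h_herm : ∀ n, (h n).IsHermitian) (h_norm : ∀ n, opNorm (h n) ≤ 1 / 2)
    (ρ σ : DensityMatrix (Fin N → Fin d)) :
    (|ρ.qfi (localHamiltonian h) - σ.qfi (localHamiltonian h)|
        ≤ 8 * Real.sqrt (1 - (ρ.fidelity σ) ^ 2) * (N : ℝ) ^ 2 ∧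
      |ρ.qfi (localHamiltonian h) - σ.qfi (localHamiltonian h)|
        ≤ 8 * ρ.buresDist σ * (N : ℝ) ^ 2 ∧
      |ρ.qfi (localHamiltonian h) - σ.qfi (localHamiltonian h)|
        ≤ 8 * Real.sqrt (traceNorm (ρ.mat - σ.mat)) * (N : ℝ) ^ 2) ∧
    (ρ.IsPure ∨ σ.IsPure →
      |ρ.qfi (localHamiltonian h) - σ.qfi (localHamiltonian h)|
        ≤ 6 * Real.sqrt (1 - (ρ.fidelity σ) ^ 2) * (N : ℝ) ^ 2 ∧
      |ρ.qfi (localHamiltonian h) - σ.qfi (localHamiltonian h)|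
        ≤ 6 * ρ.buresDist σ * (N : ℝ) ^ 2 ∧
      |ρ.qfi (localHamiltonian h) - σ.qfi (localHamiltonian h)|
        ≤ 6 * Real.sqrt (traceNorm (ρ.mat - σ.mat)) * (N : ℝ) ^ 2) := by
  have hH := localHamiltonian_isHermitian h_herm
  have key : |ρ.qfi (localHamiltonian h) - σ.qfi (localHamiltonian h)| ≤
      4 * Real.sqrt (1 - (ρ.fidelity σ) ^ 2) * (N : ℝ) ^ 2 := by
    refine (ρ.abs_qfi_sub_le σ hH).trans ?_
    have h1 := pow_le_pow_left₀ (opNorm_nonneg _) (opNorm_localHamiltonian_le h_norm) 2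
    have h2 := mul_le_mul_of_nonneg_right h1 (Real.sqrt_nonneg (1 - (ρ.fidelity σ) ^ 2))
    linarith
  have weaken {ξ x : ℝ} (hξ : 4 ≤ ξ) (hx : Real.sqrt (1 - (ρ.fidelity σ) ^ 2) ≤ x) :
      |ρ.qfi (localHamiltonian h) - σ.qfi (localHamiltonian h)| ≤ ξ * x * (N : ℝ) ^ 2 := by
    refine key.trans ?_
    have := Real.sqrt_nonneg (1 - (ρ.fidelity σ) ^ 2)
    gcongr
  have bures := ρ.sqrt_one_sub_fidelity_sq_le_buresDist σ
  have tr := bures.trans (ρ.buresDist_le_sqrt_traceNorm σ)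
  refine ⟨⟨weaken ?_ le_rfl, weaken ?_ bures, weaken ?_ tr⟩,
    fun _ => ⟨weaken ?_ le_rfl, weaken ?_ bures, weaken ?_ tr⟩⟩ <;> norm_num
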